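/- Let $\mathbf{CSRng}$ be the category of commutative semirings (with $0$ and $1$) and semiring homomorphisms. Let $\aleph_0$ be the category with objects the natural numbers and with functions $\{0,\dots,n-1\}\to\{0,\dots,m-1\}$ as maps $n\to m$; it has coproducts $(+,0)$ and a symmetric monoidal structure $(\times,1)$ given by multiplication, via the coordinatisation $a\cdot m+b\leftrightarrow(a,b)$ of $n\times m$. A symmetric monoidal Lawvere theory with biproducts is a small category $\mathbf L$ with the natural numbers as objects, with a symmetric monoidal structure and an identity-on-objects functor $\aleph_0\to\mathbf L$ that strictly preserves finite coproducts and the symmetric monoidal structure, such that the coproducts $(+,0)$ are biproducts in $\mathbf L$: $0$ is a zero object, and $n+m$ is also a product of $n$ and $m$ with projections satisfying $\pi_j\circ\kappa_i=\mathrm{id}$ for $i=j$ and $\pi_j\circ\kappa_i=0$ for $i\neq j$. These form a category $\mathbf{SMBLaw}$, whose morphisms are the identity-on-objects functors that strictly preserve all this structure. Let $\mathcal{M}at\colon\mathbf{CSRng}\to\mathbf{SMBLaw}$ send $S$ to the theory whose maps $n\to m$ are the $n\times m$ matrices over $S$, with composition $(h\circ g)(i,k)=\sum_j g(i,j)\cdot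 h(j,k)$, identity matrices as identities, the evident $0$-$1$-matrices as coprojections and projections, and tensor $(g\otimes h)((i_0,i_1),(j_0,j_1))=g(i_0,j_0)\cdot h(i_1,j_1)$; a homomorphism acts entrywise. Let $\mathcal H\colon\mathbf{SMBLaw}\to\mathbf{CSRng}$ send $\mathbf L$ to the homset $\mathbf L(1,1)$, with composition as multiplication and with the addition $f+g=[\mathrm{id},\mathrm{id}]\circ(f\oplus g)\circ\langle\mathrm{id},\mathrm{id}\rangle$, whose neutral element is the zero map. Then $\mathcal{M}at$ is left adjoint to $\mathcal H$. The adjunction $\mathcal{M}at\dashv\mathcal H$ can be chosen such that the transpose of a morphism $F\colon\mathcal{M}at(S)\to\mathbf L$ is the semiring homomorphism $S\to\mathbf L(1,1)$, $s\mapsto F(s)$, where $s$ is regarded as a $1\times 1$ matrix. -/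

import Mathlib

open CategoryTheory

universe u

/-! ### The tensor on the category of finite ordinals

Objects are natural numbers `n`, maps `n → m` are functions `Fin n → Fin m`, and `n ⊗ m = n * m`.
The coordinatisation `Fin (n * m) ≃ Fin n × Fin m`, `a * m + b ↦ (a, b)`, is
`finProdFinEquiv.symm`. -/

namespace FinOrd

/-- `f ⊗ g` on functions between finite ordinals. -/
def tensor {n m p q : ℕ} (f : Fin n → Fin p) (g : Fin m → Fin q) : Fin (n * m) → Fin (p * q) :=
  fun c => finProdFinEquiv (f (finProdFinEquiv.symm c).1, g (finProdFinEquiv.symm c).2)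

/-- The associativity map `n ⊗ (m ⊗ k) → (n ⊗ m) ⊗ k`. -/
def assoc (n m k : ℕ) : Fin (n * (m * k)) → Fin (n * m * k) := fun c =>
  let x := finProdFinEquiv.symm c
  let y := finProdFinEquiv.symm x.2
  finProdFinEquiv (finProdFinEquiv (x.1, y.1), y.2)

/-- The left unit map `1 ⊗ n → n`. -/
def leftUnit (n : ℕ) : Fin (1 * n) → Fin n := fun c => (finProdFinEquiv.symm c).2

/-- The right unit map `n ⊗ 1 → n`. -/
def rightUnit (n : ℕ) : Fin (n * 1) → Fin n := fun c => (finProdFinEquiv.symm c).1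

/-- The symmetry `n ⊗ m → m ⊗ n`. -/
def swap (n m : ℕ) : Fin (n * m) → Fin (m * n) := fun c =>
  finProdFinEquiv ((finProdFinEquiv.symm c).2, (finProdFinEquiv.symm c).1)

end FinOrd

/-! ### Lawvere theories -/

/-- A Lawvere theory: a small category with the natural numbers as objects, together with an
identity-on-objects functor `fn` from finite ordinals and functions, such that `(+, 0)`, with the
coprojections coming from finite ordinals, are finite coproducts. Composition is written in
diagrammatic order: `comp f g` is `f` followed by `g`. -/
structure LawvereTheory where
  Hom : ℕ → ℕ → Type u
  id (n : ℕ) : Hom n n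
  comp {n m k : ℕ} : Hom n m → Hom m k → Hom n k
  id_comp {n m : ℕ} (f : Hom n m) : comp (id n) f = f
  comp_id {n m : ℕ} (f : Hom n m) : comp f (id m) = f
  assoc {n m k l : ℕ} (f : Hom n m) (g : Hom m k) (h : Hom k l) :
    comp (comp f g) h = comp f (comp g h)
  fn {n m : ℕ} : (Fin n → Fin m) → Hom n m
  fn_id (n : ℕ) : fn (fun i : Fin n => i) = id n
  fn_comp {n m k : ℕ} (f : Fin n → Fin m) (g : Fin m → Fin k) :
    fn (fun i => g (f i)) = comp (fn f) (fn g)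
  /-- `0` is initial. -/
  initial {n : ℕ} (f : Hom 0 n) : f = fn Fin.elim0
  /-- `n + m` is a coproduct, with cotuples `[f, g]`. -/
  cotuple {n m k : ℕ} : Hom n k → Hom m k → Hom (n + m) k
  inl_cotuple {n m k : ℕ} (f : Hom n k) (g : Hom m k) :
    comp (fn (Fin.castAdd m)) (cotuple f g) = f
  inr_cotuple {n m k : ℕ} (f : Hom n k) (g : Hom m k) :
    comp (fn (Fin.natAdd n)) (cotuple f g) = g
  cotuple_eta {n m k : ℕ} (h : Hom (n + m) k) :
    cotuple (comp (fn (Fin.castAdd m)) h) (comp (fn (Fin.natAdd n)) h) = h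

namespace LawvereTheory

variable (L : LawvereTheory.{u})

/-- The first coprojection `n → n + m`. -/
def inl (n m : ℕ) : L.Hom n (n + m) := L.fn (Fin.castAdd m)

/-- The second coprojection `m → n + m`. -/
def inr (n m : ℕ) : L.Hom m (n + m) := L.fn (Fin.natAdd n)

end LawvereTheory

/-- A symmetric monoidal Lawvere theory: a symmetric monoidal structure on a Lawvere theory that is
strictly preserved by the functor `fn` from finite ordinals. Strictness means that the tensor of
objects is multiplication, that the unit is `1`, and that the structure isomorphisms are the images
of those of finite ordinals. So the only data is the tensor of maps, the structure isomorphisms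
have to be natural, and the coherence laws hold since they hold for finite ordinals. -/
structure SMLaw extends LawvereTheory.{u} where
  tensor {n m p q : ℕ} : Hom n p → Hom m q → Hom (n * m) (p * q)
  tensor_id (n m : ℕ) : tensor (id n) (id m) = id (n * m)
  tensor_comp {n m p q r s : ℕ} (f : Hom n p) (f' : Hom p r) (g : Hom m q) (g' : Hom q s) :
    tensor (comp f f') (comp g g') = comp (tensor f g) (tensor f' g')
  fn_tensor {n m p q : ℕ} (f : Fin n → Fin p) (g : Fin m → Fin q) :
    fn (FinOrd.tensor f g) = tensor (fn f) (fn g)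
  assoc_natural {n m k n' m' k' : ℕ} (f : Hom n n') (g : Hom m m') (h : Hom k k') :
    comp (tensor f (tensor g h)) (fn (FinOrd.assoc n' m' k')) =
      comp (fn (FinOrd.assoc n m k)) (tensor (tensor f g) h)
  leftUnit_natural {n m : ℕ} (f : Hom n m) :
    comp (tensor (id 1) f) (fn (FinOrd.leftUnit m)) = comp (fn (FinOrd.leftUnit n)) f
  rightUnit_natural {n m : ℕ} (f : Hom n m) :
    comp (tensor f (id 1)) (fn (FinOrd.rightUnit m)) = comp (fn (FinOrd.rightUnit n)) f
  swap_natural {n m p q : ℕ} (f : Hom n p) (g : Hom m q) :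
    comp (tensor f g) (fn (FinOrd.swap p q)) = comp (fn (FinOrd.swap n m)) (tensor g f)

/-- A symmetric monoidal Lawvere theory in which `(+, 0)` are biproducts: `0` is also terminal, and
`n + m` is also a product, with projections that are compatible with the coprojections. -/
structure SMBLaw extends SMLaw.{u} where
  /-- The map `n → 0`. -/
  bang (n : ℕ) : Hom n 0
  /-- `0` is terminal. -/
  terminal {n : ℕ} (f : Hom n 0) : f = bang n
  fst (n m : ℕ) : Hom (n + m) n
  snd (n m : ℕ) : Hom (n + m) m
  /-- `n + m` is a product, with tuples `⟨f, g⟩`. -/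
  tuple {k n m : ℕ} : Hom k n → Hom k m → Hom k (n + m)
  tuple_fst {k n m : ℕ} (f : Hom k n) (g : Hom k m) : comp (tuple f g) (fst n m) = f
  tuple_snd {k n m : ℕ} (f : Hom k n) (g : Hom k m) : comp (tuple f g) (snd n m) = g
  tuple_eta {k n m : ℕ} (h : Hom k (n + m)) :
    tuple (comp h (fst n m)) (comp h (snd n m)) = h
  inl_fst (n m : ℕ) : comp (toLawvereTheory.inl n m) (fst n m) = id n
  inl_snd (n m : ℕ) : comp (toLawvereTheory.inl n m) (snd n m) = comp (bang n) (fn Fin.elim0)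
  inr_fst (n m : ℕ) : comp (toLawvereTheory.inr n m) (fst n m) = comp (bang m) (fn Fin.elim0)
  inr_snd (n m : ℕ) : comp (toLawvereTheory.inr n m) (snd n m) = id m

namespace SMBLaw

/-- A morphism of symmetric monoidal Lawvere theories with biproducts: an identity-on-objects
functor that strictly preserves coproducts, the symmetric monoidal structure, and biproducts.
Every function between finite ordinals is a cotuple of coprojections, so that preserving
coproducts strictly is the same as preserving `fn`; this covers the structure isomorphisms of the
monoidal structure as well. -/
@[ext]
structure Morphism (L K : SMBLaw.{u}) where
  map {n m : ℕ} : L.Hom n m → K.Hom n m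
  map_id (n : ℕ) : map (L.id n) = K.id n
  map_comp {n m k : ℕ} (f : L.Hom n m) (g : L.Hom m k) :
    map (L.comp f g) = K.comp (map f) (map g)
  map_fn {n m : ℕ} (f : Fin n → Fin m) : map (L.fn f) = K.fn f
  map_tensor {n m p q : ℕ} (f : L.Hom n p) (g : L.Hom m q) :
    map (L.tensor f g) = K.tensor (map f) (map g)
  map_fst (n m : ℕ) : map (L.fst n m) = K.fst n m
  map_snd (n m : ℕ) : map (L.snd n m) = K.snd n m

/-- The category of symmetric monoidal Lawvere theories with biproducts. -/
instance : Category SMBLaw.{u} where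
  Hom L K := Morphism L K
  id L :=
    { map := fun f => f
      map_id := fun _ => rfl
      map_comp := fun _ _ => rfl
      map_fn := fun _ => rfl
      map_tensor := fun _ _ => rfl
      map_fst := fun _ _ => rfl
      map_snd := fun _ _ => rfl }
  comp F G :=
    { map := fun f => G.map (F.map f)
      map_id := fun n => by rw [F.map_id, G.map_id]
      map_comp := fun f g => by rw [F.map_comp, G.map_comp]
      map_fn := fun f => by rw [F.map_fn, G.map_fn]
      map_tensor := fun f g => by rw [F.map_tensor, G.map_tensor]
      map_fst := fun n m => by rw [F.map_fst, G.map_fst]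
      map_snd := fun n m => by rw [F.map_snd, G.map_snd] }

/-! ### The semiring of endomaps of `1` -/

section Semiring

variable (L : SMBLaw.{u})

/-- The zero map `n → 0 → m`. -/
def zero (n m : ℕ) : L.Hom n m := L.comp (L.bang n) (L.fn Fin.elim0)

/-- `f ⊕ g = [inl ∘ f, inr ∘ g]`. -/
def oplus {n m p q : ℕ} (f : L.Hom n p) (g : L.Hom m q) : L.Hom (n + m) (p + q) :=
  L.cotuple (L.comp f (L.inl p q)) (L.comp g (L.inr p q))

/-- The sum of parallel maps: diagonal, then `f ⊕ g`, then codiagonal. -/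
def add {n m : ℕ} (f g : L.Hom n m) : L.Hom n m :=
  L.comp (L.tuple (L.id n) (L.id n)) (L.comp (L.oplus f g) (L.cotuple (L.id m) (L.id m)))

variable {L}

theorem inl_cotuple' {n m k : ℕ} (f : L.Hom n k) (g : L.Hom m k) :
    L.comp (L.inl n m) (L.cotuple f g) = f := L.inl_cotuple f g

theorem inr_cotuple' {n m k : ℕ} (f : L.Hom n k) (g : L.Hom m k) :
    L.comp (L.inr n m) (L.cotuple f g) = g := L.inr_cotuple f g

theorem cotuple_ext {n m k : ℕ} {f g : L.Hom (n + m) k}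
    (h₁ : L.comp (L.inl n m) f = L.comp (L.inl n m) g)
    (h₂ : L.comp (L.inr n m) f = L.comp (L.inr n m) g) : f = g := by
  rw [← L.cotuple_eta f, ← L.cotuple_eta g]
  exact congrArg₂ L.cotuple h₁ h₂

theorem tuple_ext {k n m : ℕ} {f g : L.Hom k (n + m)}
    (h₁ : L.comp f (L.fst n m) = L.comp g (L.fst n m))
    (h₂ : L.comp f (L.snd n m) = L.comp g (L.snd n m)) : f = g := by
  rw [← L.tuple_eta f, ← L.tuple_eta g]
  exact congrArg₂ L.tuple h₁ h₂

theorem comp_zero {n m k : ℕ} (f : L.Hom n m) : L.comp f (L.zero m k) = L.zero n k := by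
  rw [zero, zero, ← L.assoc, L.terminal (L.comp f (L.bang m))]

theorem zero_comp {n m k : ℕ} (f : L.Hom m k) : L.comp (L.zero n m) f = L.zero n k := by
  rw [zero, zero, L.assoc, L.initial (L.comp _ f)]

theorem comp_cotuple {n m k l : ℕ} (f : L.Hom n k) (g : L.Hom m k) (h : L.Hom k l) :
    L.comp (L.cotuple f g) h = L.cotuple (L.comp f h) (L.comp g h) := by
  apply cotuple_ext
  · rw [← L.assoc, inl_cotuple', inl_cotuple']
  · rw [← L.assoc, inr_cotuple', inr_cotuple']

theorem comp_tuple {l k n m : ℕ} (h : L.Hom l k) (f : L.Hom k n) (g : L.Hom k m) :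
    L.comp h (L.tuple f g) = L.tuple (L.comp h f) (L.comp h g) := by
  apply tuple_ext
  · rw [L.assoc, L.tuple_fst, L.tuple_fst]
  · rw [L.assoc, L.tuple_snd, L.tuple_snd]

theorem oplus_eq {n m p q : ℕ} (f : L.Hom n p) (g : L.Hom m q) :
    L.oplus f g = L.tuple (L.comp (L.fst n m) f) (L.comp (L.snd n m) g) := by
  apply cotuple_ext
  · apply tuple_ext
    · rw [oplus, inl_cotuple', L.assoc, L.inl_fst, L.comp_id, L.assoc, L.tuple_fst, ← L.assoc,
        L.inl_fst, L.id_comp]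
    · rw [oplus, inl_cotuple', L.assoc, L.inl_snd, L.assoc, L.tuple_snd,
        ← L.assoc (L.inl n m), L.inl_snd]
      exact (comp_zero f).trans (zero_comp g).symm
  · apply tuple_ext
    · rw [oplus, inr_cotuple', L.assoc, L.inr_fst, L.assoc, L.tuple_fst,
        ← L.assoc (L.inr n m), L.inr_fst]
      exact (comp_zero g).trans (zero_comp f).symm
    · rw [oplus, inr_cotuple', L.assoc, L.inr_snd, L.comp_id, L.assoc, L.tuple_snd, ← L.assoc,
        L.inr_snd, L.id_comp]

theorem add_eq_cotuple {n m : ℕ} (f g : L.Hom n m) :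
    L.add f g = L.comp (L.tuple (L.id n) (L.id n)) (L.cotuple f g) := by
  rw [add, oplus, comp_cotuple, L.assoc, L.assoc, inl_cotuple', inr_cotuple', L.comp_id, L.comp_id]

theorem add_eq_tuple {n m : ℕ} (f g : L.Hom n m) :
    L.add f g = L.comp (L.tuple f g) (L.cotuple (L.id m) (L.id m)) := by
  rw [add, oplus_eq, ← L.assoc, comp_tuple, ← L.assoc, ← L.assoc, L.tuple_fst, L.tuple_snd,
    L.id_comp, L.id_comp]

theorem add_comp {n m k : ℕ} (f g : L.Hom n m) (h : L.Hom m k) :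
    L.comp (L.add f g) h = L.add (L.comp f h) (L.comp g h) := by
  rw [add_eq_cotuple, add_eq_cotuple, L.assoc, comp_cotuple]

theorem comp_add {n m k : ℕ} (h : L.Hom n m) (f g : L.Hom m k) :
    L.comp h (L.add f g) = L.add (L.comp h f) (L.comp h g) := by
  rw [add_eq_tuple, add_eq_tuple, ← L.assoc, comp_tuple]

theorem add_add_add_comm' {n m : ℕ} (a b c d : L.Hom n m) :
    L.add (L.add a b) (L.add c d) = L.add (L.add a c) (L.add b d) := by
  have h : L.cotuple (L.add a b) (L.add c d) = L.add (L.cotuple a c) (L.cotuple b d) := by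
    apply cotuple_ext
    · rw [inl_cotuple', comp_add, inl_cotuple', inl_cotuple']
    · rw [inr_cotuple', comp_add, inr_cotuple', inr_cotuple']
  rw [add_eq_cotuple, h, comp_add, ← add_eq_cotuple, ← add_eq_cotuple]

theorem add_zero' {n m : ℕ} (f : L.Hom n m) : L.add f (L.zero n m) = f := by
  have h : L.cotuple f (L.zero n m) = L.comp (L.fst n n) f := by
    apply cotuple_ext
    · rw [inl_cotuple', ← L.assoc, L.inl_fst, L.id_comp]
    · rw [inr_cotuple', ← L.assoc, L.inr_fst]
      exact (zero_comp f).symm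
  rw [add_eq_cotuple, h, ← L.assoc, L.tuple_fst, L.id_comp]

theorem zero_add' {n m : ℕ} (f : L.Hom n m) : L.add (L.zero n m) f = f := by
  have h : L.cotuple (L.zero n m) f = L.comp (L.snd n n) f := by
    apply cotuple_ext
    · rw [inl_cotuple', ← L.assoc, L.inl_snd]
      exact (zero_comp f).symm
    · rw [inr_cotuple', ← L.assoc, L.inr_snd, L.id_comp]
  rw [add_eq_cotuple, h, ← L.assoc, L.tuple_snd, L.id_comp]

theorem add_comm' {n m : ℕ} (f g : L.Hom n m) : L.add f g = L.add g f := by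
  have h := add_add_add_comm' (L.zero n m) f g (L.zero n m)
  rwa [zero_add', add_zero', zero_add', add_zero'] at h

theorem add_assoc' {n m : ℕ} (f g h : L.Hom n m) :
    L.add (L.add f g) h = L.add f (L.add g h) := by
  have e := add_add_add_comm' f g (L.zero n m) h
  rwa [zero_add', add_zero'] at e

/-- Composition of endomaps of the tensor unit is commutative. -/
theorem comp_comm' (s t : L.Hom 1 1) : L.comp s t = L.comp t s := by
  have hl : L.fn (FinOrd.leftUnit 1) = L.id 1 := by
    rw [← L.fn_id]; congr 1; funext i; exact Subsingleton.elim _ _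
  have hr : L.fn (FinOrd.rightUnit 1) = L.id 1 := by
    rw [← L.fn_id]; congr 1; funext i; exact Subsingleton.elim _ _
  have h₁ : L.tensor (L.id 1) t = t := by
    have h := L.leftUnit_natural t
    rw [hl] at h
    exact (L.comp_id _).symm.trans (h.trans (L.id_comp t))
  have h₂ : L.tensor s (L.id 1) = s := by
    have h := L.rightUnit_natural s
    rw [hr] at h
    exact (L.comp_id _).symm.trans (h.trans (L.id_comp s))
  have e₁ := L.tensor_comp s (L.id 1) (L.id 1) t
  have e₂ := L.tensor_comp (L.id 1) s t (L.id 1)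
  rw [h₁, h₂, L.comp_id, L.id_comp] at e₁
  rw [h₁, h₂, L.comp_id, L.id_comp] at e₂
  exact e₁.symm.trans e₂

variable (L)

/-- The commutative semiring `L(1, 1)`: multiplication is composition, and addition is the addition
of parallel maps given by the biproducts. -/
instance endCommSemiring : CommSemiring (L.Hom 1 1) where
  add f g := L.add f g
  zero := L.zero 1 1
  mul f g := L.comp g f
  one := L.id 1
  nsmul := @nsmulRec _ ⟨L.zero 1 1⟩ ⟨fun f g => L.add f g⟩
  add_assoc := add_assoc'
  add_comm := add_comm'
  zero_add := zero_add'
  add_zero := add_zero'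
  mul_assoc f g h := (L.assoc h g f).symm
  mul_comm f g := comp_comm' g f
  one_mul := L.comp_id
  mul_one := L.id_comp
  zero_mul := comp_zero
  mul_zero := zero_comp
  left_distrib f g h := add_comp g h f
  right_distrib f g h := comp_add h f g

variable {L}

theorem Morphism.map_cotuple {K : SMBLaw.{u}} (F : Morphism L K) {n m k : ℕ} (f : L.Hom n k)
    (g : L.Hom m k) : F.map (L.cotuple f g) = K.cotuple (F.map f) (F.map g) := by
  apply cotuple_ext
  · have h := congrArg F.map (L.inl_cotuple f g)
    rw [F.map_comp, F.map_fn] at h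
    exact h.trans (inl_cotuple' _ _).symm
  · have h := congrArg F.map (L.inr_cotuple f g)
    rw [F.map_comp, F.map_fn] at h
    exact h.trans (inr_cotuple' _ _).symm

theorem Morphism.map_tuple {K : SMBLaw.{u}} (F : Morphism L K) {n m k : ℕ} (f : L.Hom k n)
    (g : L.Hom k m) : F.map (L.tuple f g) = K.tuple (F.map f) (F.map g) := by
  apply tuple_ext
  · rw [← F.map_fst, ← F.map_comp, L.tuple_fst, F.map_fst, K.tuple_fst]
  · rw [← F.map_snd, ← F.map_comp, L.tuple_snd, F.map_snd, K.tuple_snd]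

theorem Morphism.map_zero {K : SMBLaw.{u}} (F : Morphism L K) (n m : ℕ) :
    F.map (L.zero n m) = K.zero n m := by
  rw [zero, zero, F.map_comp, F.map_fn, K.terminal (F.map (L.bang n))]

theorem Morphism.map_add {K : SMBLaw.{u}} (F : Morphism L K) {n m : ℕ} (f g : L.Hom n m) :
    F.map (L.add f g) = K.add (F.map f) (F.map g) := by
  rw [add_eq_cotuple, add_eq_cotuple, F.map_comp, F.map_tuple, F.map_cotuple, F.map_id]

/-- A morphism acts on endomaps of `1` as a homomorphism of semirings. -/
def Morphism.endHom {K : SMBLaw.{u}} (F : Morphism L K) : L.Hom 1 1 →+* K.Hom 1 1 where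
  toFun := F.map
  map_one' := F.map_id 1
  map_mul' f g := F.map_comp g f
  map_zero' := F.map_zero 1 1
  map_add' := F.map_add

end Semiring

/-- The functor `H`, given by `L ↦ L(1, 1)`. -/
def homFunctor : SMBLaw.{u} ⥤ CommSemiRingCat.{u} where
  obj L := CommSemiRingCat.of (L.Hom 1 1)
  map F := CommSemiRingCat.ofHom (Morphism.endHom F)

end SMBLaw

/-! ### Matrices -/

namespace MatLaw

section

variable (S : Type u) [CommSemiring S]

/-- The `0`-`1`-matrix of a function: the image of a function under finite ordinals → matrices. -/
def fn {n m : ℕ} (f : Fin n → Fin m) : Matrix (Fin n) (Fin m) S :=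
  Matrix.of fun i j => if f i = j then 1 else 0

variable {S}

/-- The tensor of matrices, `(g ⊗ h)((i₀, i₁), (j₀, j₁)) = g(i₀, j₀) * h(i₁, j₁)`. -/
def tensor {n m p q : ℕ} (g : Matrix (Fin n) (Fin p) S) (h : Matrix (Fin m) (Fin q) S) :
    Matrix (Fin (n * m)) (Fin (p * q)) S :=
  Matrix.of fun i j =>
    g (finProdFinEquiv.symm i).1 (finProdFinEquiv.symm j).1 *
      h (finProdFinEquiv.symm i).2 (finProdFinEquiv.symm j).2

theorem fn_mul {n m k : ℕ} (f : Fin n → Fin m) (h : Matrix (Fin m) (Fin k) S) :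
    fn S f * h = Matrix.of fun i j => h (f i) j := by
  ext i j
  simp [fn, Matrix.mul_apply]

theorem mul_fn_of_leftInverse {n m k : ℕ} (f : Fin m → Fin k) (g : Fin k → Fin m)
    (hfg : ∀ i, f (g i) = i) (hgf : ∀ i, g (f i) = i) (h : Matrix (Fin n) (Fin m) S) :
    h * fn S f = Matrix.of fun i j => h i (g j) := by
  ext i j
  have e : ∀ x, f x = j ↔ x = g j := fun x =>
    ⟨fun hx => by rw [← hx, hgf], fun hx => by rw [hx, hfg]⟩
  simp [fn, Matrix.mul_apply, e]

variable (S) in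
/-- The first projection `n + m → n`. -/
def fst (n m : ℕ) : Matrix (Fin (n + m)) (Fin n) S :=
  Matrix.of fun i j => if i = Fin.castAdd m j then 1 else 0

variable (S) in
/-- The second projection `n + m → m`. -/
def snd (n m : ℕ) : Matrix (Fin (n + m)) (Fin m) S :=
  Matrix.of fun i j => if i = Fin.natAdd n j then 1 else 0

theorem mul_fst {k n m : ℕ} (h : Matrix (Fin k) (Fin (n + m)) S) :
    h * fst S n m = Matrix.of fun i j => h i (Fin.castAdd m j) := by
  ext i j
  simp [fst, Matrix.mul_apply]

theorem mul_snd {k n m : ℕ} (h : Matrix (Fin k) (Fin (n + m)) S) :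
    h * snd S n m = Matrix.of fun i j => h i (Fin.natAdd n j) := by
  ext i j
  simp [snd, Matrix.mul_apply]

theorem castAdd_ne_natAdd {n m : ℕ} (i : Fin n) (j : Fin m) :
    Fin.castAdd m i ≠ Fin.natAdd n j := by
  intro h
  have := congrArg Fin.val h
  simp at this
  omega

end

/-- The symmetric monoidal Lawvere theory with biproducts of matrices over `S`: a map `n → m` is an
`n × m` matrix, and `g` followed by `h` is the matrix product `g * h`. -/
def ofSemiring (S : Type u) [CommSemiring S] : SMBLaw.{u} where
  Hom n m := Matrix (Fin n) (Fin m) S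
  id n := 1
  comp g h := g * h
  id_comp := Matrix.one_mul
  comp_id := Matrix.mul_one
  assoc := Matrix.mul_assoc
  fn := fn S
  fn_id n := by
    ext i j
    simp [fn, Matrix.one_apply]
  fn_comp f g := by
    rw [fn_mul]
    rfl
  initial f := by
    ext i
    exact i.elim0
  cotuple f g := Matrix.of fun i j => Fin.append f g i j
  inl_cotuple f g := by
    rw [fn_mul]
    ext i j
    exact congrFun (Fin.append_left f g i) j
  inr_cotuple f g := by
    rw [fn_mul]
    ext i j
    exact congrFun (Fin.append_right f g i) j
  cotuple_eta h := by
    rw [fn_mul, fn_mul]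
    ext i j
    refine Fin.addCases (fun i => ?_) (fun i => ?_) i
    · exact congrFun (Fin.append_left _ _ i) j
    · exact congrFun (Fin.append_right _ _ i) j
  tensor := tensor
  tensor_id n m := by
    ext i j
    rw [← finProdFinEquiv.apply_symm_apply i, ← finProdFinEquiv.apply_symm_apply j]
    generalize finProdFinEquiv.symm i = x
    generalize finProdFinEquiv.symm j = y
    simp [-finProdFinEquiv_symm_apply, tensor, Matrix.one_apply, ← ite_and, Prod.ext_iff, and_comm]
  tensor_comp f f' g g' := by
    ext i j
    simp only [tensor, Matrix.of_apply, Matrix.mul_apply, Finset.sum_mul_sum]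
    rw [← Finset.sum_product', ← finProdFinEquiv.sum_comp]
    refine Finset.sum_congr rfl fun x _ => ?_
    simp [-finProdFinEquiv_symm_apply, mul_mul_mul_comm]
  fn_tensor f g := by
    ext i j
    rw [← finProdFinEquiv.apply_symm_apply j]
    generalize finProdFinEquiv.symm j = y
    simp [-finProdFinEquiv_symm_apply, tensor, fn, FinOrd.tensor, ← ite_and, Prod.ext_iff, and_comm]
  assoc_natural {n m k n' m' k'} f g h := by
    rw [fn_mul, mul_fn_of_leftInverse (FinOrd.assoc n' m' k') (fun c =>
      let x := finProdFinEquiv.symm c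
      let y := finProdFinEquiv.symm x.1
      finProdFinEquiv (y.1, finProdFinEquiv (y.2, x.2)))]
    · ext i j
      simp [-finProdFinEquiv_symm_apply, tensor, FinOrd.assoc, mul_assoc]
    · intro c
      simp [-finProdFinEquiv_symm_apply, FinOrd.assoc]
    · intro c
      simp [-finProdFinEquiv_symm_apply, FinOrd.assoc]
  leftUnit_natural {n m} f := by
    rw [fn_mul, mul_fn_of_leftInverse (FinOrd.leftUnit m) (fun c => finProdFinEquiv (0, c))]
    · ext i j
      simp [-finProdFinEquiv_symm_apply, tensor, FinOrd.leftUnit, Matrix.one_apply, Subsingleton.elim _ (0 : Fin 1)]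
    · intro c
      simp [-finProdFinEquiv_symm_apply, FinOrd.leftUnit]
    · intro c
      rw [← finProdFinEquiv.apply_symm_apply c]
      generalize finProdFinEquiv.symm c = y
      simp [-finProdFinEquiv_symm_apply, FinOrd.leftUnit, Prod.ext_iff, Subsingleton.elim _ (0 : Fin 1)]
  rightUnit_natural {n m} f := by
    rw [fn_mul, mul_fn_of_leftInverse (FinOrd.rightUnit m) (fun c => finProdFinEquiv (c, 0))]
    · ext i j
      simp [-finProdFinEquiv_symm_apply, tensor, FinOrd.rightUnit, Matrix.one_apply, Subsingleton.elim _ (0 : Fin 1)]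
    · intro c
      simp [-finProdFinEquiv_symm_apply, FinOrd.rightUnit]
    · intro c
      rw [← finProdFinEquiv.apply_symm_apply c]
      generalize finProdFinEquiv.symm c = y
      simp [-finProdFinEquiv_symm_apply, FinOrd.rightUnit, Prod.ext_iff, Subsingleton.elim _ (0 : Fin 1)]
  swap_natural {n m p q} f g := by
    rw [fn_mul, mul_fn_of_leftInverse (FinOrd.swap p q) (FinOrd.swap q p)]
    · ext i j
      simp [-finProdFinEquiv_symm_apply, tensor, FinOrd.swap, mul_comm]
    · intro c
      simp [-finProdFinEquiv_symm_apply, FinOrd.swap]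
    · intro c
      simp [-finProdFinEquiv_symm_apply, FinOrd.swap]
  bang n := 0
  terminal f := by
    ext i j
    exact j.elim0
  fst := fst S
  snd := snd S
  tuple f g := Matrix.of fun i j => Fin.append (f i) (g i) j
  tuple_fst f g := by
    rw [mul_fst]
    ext i j
    simp
  tuple_snd f g := by
    rw [mul_snd]
    ext i j
    simp
  tuple_eta h := by
    rw [mul_fst, mul_snd]
    ext i j
    refine Fin.addCases (fun j => ?_) (fun j => ?_) j
    · simp
    · simp
  inl_fst n m := by
    rw [mul_fst]
    ext i j
    simp [LawvereTheory.inl, fn, Matrix.one_apply]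
  inl_snd n m := by
    rw [mul_snd, Matrix.zero_mul]
    ext i j
    simp [LawvereTheory.inl, fn, castAdd_ne_natAdd]
  inr_fst n m := by
    rw [mul_fst, Matrix.zero_mul]
    ext i j
    simp [LawvereTheory.inr, fn, (castAdd_ne_natAdd _ _).symm]
  inr_snd n m := by
    rw [mul_snd]
    ext i j
    simp [LawvereTheory.inr, fn, Matrix.one_apply]

/-- A homomorphism of semirings acts entrywise on matrices. -/
def mapHom {S R : Type u} [CommSemiring S] [CommSemiring R] (f : S →+* R) :
    SMBLaw.Morphism (ofSemiring S) (ofSemiring R) where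
  map {n m} (h : Matrix (Fin n) (Fin m) S) := (h.map f : Matrix (Fin n) (Fin m) R)
  map_id n := Matrix.map_one f f.map_zero f.map_one
  map_comp g h := Matrix.map_mul
  map_fn {n m} φ := by
    change (fn S φ).map f = fn R φ
    ext i j
    simp [fn, apply_ite f]
  map_tensor {n m p q} (g : Matrix (Fin n) (Fin p) S) (h : Matrix (Fin m) (Fin q) S) := by
    change (tensor g h).map f = tensor (g.map f) (h.map f)
    ext i j
    simp [tensor]
  map_fst n m := by
    change (fst S n m).map f = fst R n m
    ext i j
    simp [fst, apply_ite f]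
  map_snd n m := by
    change (snd S n m).map f = snd R n m
    ext i j
    simp [snd, apply_ite f]

end MatLaw

/-- The functor `Mat`, sending a commutative semiring to its theory of matrices. -/
def matFunctor : CommSemiRingCat.{u} ⥤ SMBLaw.{u} where
  obj S := MatLaw.ofSemiring S
  map f := MatLaw.mapHom f.hom

/-! In a theory with biproducts, `n` is the `n`-fold biproduct of `1`, so a map `f : n → m` is the
same as its matrix of scalars `inj i`, then `f`, then `proj j`, in `L(1,1)`. The resolution of the
identity `sum_proj_inj` turns composition into the matrix product. Tensors become tensors of
matrices because `inj` and `proj` at a pair are tensors of those at its components (`inj_tensor`,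
`proj_tensor`) and scalars tensor by composing (`tensor_eq_comp`). Hence `L` is isomorphic to the
matrix theory over `L(1,1)`, and the inverse isomorphism `ofEntriesMorphism` is the counit.

A homomorphism `S → L(1,1)` extends to matrices entrywise, followed by the counit. Conversely, a
morphism `F` out of matrices preserves `inj` and `proj`, so the entries of `F(M)` are the values of
`F` on the entries of `M`, seen as `1 × 1` matrices (`inj_comp_proj`). The two passages are
therefore mutually inverse. -/

namespace SMBLaw

/-! ### Sums of maps, and each object as a biproduct of copies of `1` -/

section Entries

variable {L : SMBLaw.{u}}

/-- Parallel maps form a commutative monoid under the addition given by the biproducts. -/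
instance homAddCommMonoid (n m : ℕ) : AddCommMonoid (L.Hom n m) where
  -- For `n = m = 1` these are the operations of `endCommSemiring`, so sums in `L(1,1)` may be read
  -- in either structure.
  add f g := L.add f g
  zero := L.zero n m
  nsmul := @nsmulRec _ ⟨L.zero n m⟩ ⟨fun f g => L.add f g⟩
  add_assoc := add_assoc'
  add_comm := add_comm'
  zero_add := zero_add'
  add_zero := add_zero'

theorem comp_sum {ι : Type*} (s : Finset ι) {n m k : ℕ} (f : L.Hom n m) (g : ι → L.Hom m k) :
    L.comp f (∑ i ∈ s, g i) = ∑ i ∈ s, L.comp f (g i) :=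
  map_sum (⟨⟨fun h => L.comp f h, comp_zero f⟩, comp_add f⟩ : L.Hom m k →+ L.Hom n k) g s

theorem sum_comp {ι : Type*} (s : Finset ι) {n m k : ℕ} (f : ι → L.Hom n m) (g : L.Hom m k) :
    L.comp (∑ i ∈ s, f i) g = ∑ i ∈ s, L.comp (f i) g :=
  map_sum (⟨⟨fun h => L.comp h g, zero_comp g⟩, fun a b => add_comp a b g⟩ :
    L.Hom n m →+ L.Hom n k) f s

variable (L) in
/-- The coprojection `1 → n` onto the `i`-th summand. -/
def inj {n : ℕ} (i : Fin n) : L.Hom 1 n := L.fn fun _ => i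

theorem inj_fn {n m : ℕ} (f : Fin n → Fin m) (i : Fin n) :
    L.comp (L.inj i) (L.fn f) = L.inj (f i) :=
  (L.fn_comp _ f).symm

theorem inj_inl {n m : ℕ} (i : Fin n) :
    L.comp (L.inj i) (L.inl n m) = L.inj (Fin.castAdd m i) :=
  inj_fn _ i

theorem inj_inr {n m : ℕ} (i : Fin m) :
    L.comp (L.inj i) (L.inr n m) = L.inj (Fin.natAdd n i) :=
  inj_fn _ i

theorem inj_zero_one : L.inj (0 : Fin 1) = L.id 1 := by
  rw [← L.fn_id, inj]
  congr 1
  funext i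
  exact Subsingleton.elim _ _

theorem inj_natAdd_zero (n : ℕ) : L.inj (Fin.natAdd n (0 : Fin 1)) = L.inr n 1 := by
  rw [← inj_inr, inj_zero_one, L.id_comp]

/-- By induction, since `0` is initial and `n + 1` is the coproduct of `n` and `1`. This is the
uniqueness half of `n` being a copower of `1`; the next lemma is the existence half. -/
theorem hom_ext_inj {n m : ℕ} {f g : L.Hom n m}
    (h : ∀ i, L.comp (L.inj i) f = L.comp (L.inj i) g) : f = g := by
  induction n with
  | zero => rw [L.initial f, L.initial g]
  | succ n ih =>
    apply cotuple_ext (n := n) (m := 1)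
    · apply ih
      intro i
      rw [← L.assoc, ← L.assoc, inj_inl]
      exact h _
    · rw [← inj_natAdd_zero]
      exact h _

theorem exists_inj_comp_eq {n m : ℕ} (g : Fin n → L.Hom 1 m) :
    ∃ h : L.Hom n m, ∀ i, L.comp (L.inj i) h = g i := by
  induction n with
  | zero => exact ⟨L.fn Fin.elim0, fun i => i.elim0⟩
  | succ n ih =>
    obtain ⟨h, hh⟩ := ih fun i => g (Fin.castAdd 1 i)
    refine ⟨L.cotuple h (g (Fin.natAdd n 0)), fun i => ?_⟩
    refine Fin.addCases (m := n) (n := 1) (fun i => ?_) (fun i => ?_) i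
    · rw [← inj_inl, L.assoc, inl_cotuple', hh]
    · obtain rfl := Subsingleton.elim 0 i
      rw [inj_natAdd_zero, inr_cotuple']

variable (L) in
/-- The projection `n → 1` onto the `j`-th factor. -/
noncomputable def proj {n : ℕ} (j : Fin n) : L.Hom n 1 :=
  (exists_inj_comp_eq fun i => if i = j then L.id 1 else L.zero 1 1).choose

theorem inj_proj {n : ℕ} (i j : Fin n) :
    L.comp (L.inj i) (L.proj j) = if i = j then L.id 1 else L.zero 1 1 :=
  (exists_inj_comp_eq fun i => if i = j then L.id 1 else L.zero 1 1).choose_spec i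

/-- Projections are recognised by their Kronecker delta values on coprojections, so the choice in
`proj` is harmless. -/
theorem eq_proj {n : ℕ} {j : Fin n} {p : L.Hom n 1}
    (h : ∀ i, L.comp (L.inj i) p = if i = j then L.id 1 else L.zero 1 1) : p = L.proj j :=
  hom_ext_inj fun i => (h i).trans (inj_proj i j).symm

theorem proj_zero_one : L.proj (0 : Fin 1) = L.id 1 := by
  refine (eq_proj fun i => ?_).symm
  obtain rfl := Subsingleton.elim 0 i
  rw [if_pos rfl, inj_zero_one, L.id_comp]

/-- On the `i`-th coprojection only the `i`-th summand survives. Inserting this sum in the middle of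
a composite yields the matrix product. -/
theorem sum_proj_inj (n : ℕ) : ∑ j : Fin n, L.comp (L.proj j) (L.inj j) = L.id n := by
  apply hom_ext_inj
  intro i
  rw [comp_sum, L.comp_id, Finset.sum_eq_single i]
  · rw [← L.assoc, inj_proj, if_pos rfl, L.id_comp]
  · intro j _ hj
    rw [← L.assoc, inj_proj, if_neg hj.symm]
    exact zero_comp _
  · exact fun h => (h (Finset.mem_univ i)).elim

theorem hom_ext_proj {n m : ℕ} {f g : L.Hom n m}
    (h : ∀ j, L.comp f (L.proj j) = L.comp g (L.proj j)) : f = g := by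
  rw [← L.comp_id f, ← L.comp_id g, ← sum_proj_inj, comp_sum, comp_sum]
  refine Finset.sum_congr rfl fun j _ => ?_
  rw [← L.assoc, h, L.assoc]

/-- The delta values that characterise `proj` involve only coprojections, identities and zero maps,
all of which `F` preserves. -/
theorem Morphism.map_proj {K : SMBLaw.{u}} (F : Morphism L K) {n : ℕ} (j : Fin n) :
    F.map (L.proj j) = K.proj j := by
  refine eq_proj fun i => ?_
  have h : F.map (L.inj i) = K.inj i := F.map_fn _
  rw [← h, ← F.map_comp, inj_proj, apply_ite F.map, F.map_id, F.map_zero]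

/-! ### The tensor of scalars, coprojections and projections -/

/-- Eckmann–Hilton: the unit maps at `1` are identities, so tensoring a scalar with `id 1` does
nothing, and interchange applied to `(a, id)` and `(id, b)` gives the claim. -/
theorem tensor_eq_comp (a b : L.Hom 1 1) : L.tensor a b = L.comp a b := by
  have hl : L.fn (FinOrd.leftUnit 1) = L.id 1 := by
    rw [← L.fn_id]; congr 1; funext i; exact Subsingleton.elim _ _
  have hr : L.fn (FinOrd.rightUnit 1) = L.id 1 := by
    rw [← L.fn_id]; congr 1; funext i; exact Subsingleton.elim _ _
  have h₁ : L.tensor (L.id 1) b = b := by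
    have h := L.leftUnit_natural b
    rw [hl] at h
    exact (L.comp_id _).symm.trans (h.trans (L.id_comp b))
  have h₂ : L.tensor a (L.id 1) = a := by
    have h := L.rightUnit_natural a
    rw [hr] at h
    exact (L.comp_id _).symm.trans (h.trans (L.id_comp a))
  have e := L.tensor_comp a (L.id 1) (L.id 1) b
  rwa [h₁, h₂, L.comp_id, L.id_comp] at e

theorem inj_tensor {n m : ℕ} (i : Fin n) (j : Fin m) :
    L.inj (finProdFinEquiv (i, j)) = L.tensor (L.inj i) (L.inj j) :=
  L.fn_tensor (fun _ : Fin 1 => i) (fun _ : Fin 1 => j)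

theorem proj_tensor {n m : ℕ} (i : Fin n) (j : Fin m) :
    L.proj (finProdFinEquiv (i, j)) = L.tensor (L.proj i) (L.proj j) := by
  refine (eq_proj fun x => ?_).symm
  obtain ⟨⟨a, b⟩, rfl⟩ := finProdFinEquiv.surjective x
  rw [inj_tensor]
  refine (L.tensor_comp _ _ _ _).symm.trans ?_
  -- The delta at a pair is the composite of the deltas at its components.
  rw [tensor_eq_comp, inj_proj, inj_proj]
  by_cases ha : a = i
  · by_cases hb : b = j
    · rw [if_pos ha, if_pos hb, if_pos (by rw [ha, hb]), L.id_comp]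
    · rw [if_neg hb, if_neg fun h => hb (Prod.ext_iff.1 (finProdFinEquiv.injective h)).2]
      exact comp_zero _
  · rw [if_neg ha, if_neg fun h => ha (Prod.ext_iff.1 (finProdFinEquiv.injective h)).1]
    exact zero_comp _

/-! ### Maps as matrices over the semiring of scalars -/

/-- The matrix of a map. -/
noncomputable def entries {n m : ℕ} (f : L.Hom n m) : Matrix (Fin n) (Fin m) (L.Hom 1 1) :=
  Matrix.of fun i j => L.comp (L.inj i) (L.comp f (L.proj j))

/-- The map with a given matrix. -/
noncomputable def ofEntries {n m : ℕ} (M : Matrix (Fin n) (Fin m) (L.Hom 1 1)) : L.Hom n m :=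
  ∑ i, ∑ j, L.comp (L.proj i) (L.comp (M i j) (L.inj j))

/-- The projections are jointly monic and the coprojections jointly epic. -/
theorem entries_injective {n m : ℕ} : Function.Injective (entries (L := L) (n := n) (m := m)) :=
  fun _ _ h => hom_ext_proj fun j => hom_ext_inj fun i => congrFun (congrFun h i) j

theorem entries_ofEntries {n m : ℕ} (M : Matrix (Fin n) (Fin m) (L.Hom 1 1)) :
    entries (ofEntries M) = M := by
  ext i j
  change L.comp (L.inj i) (L.comp (ofEntries M) (L.proj j)) = M i j
  rw [ofEntries, ← L.assoc, comp_sum, Finset.sum_eq_single i, comp_sum, sum_comp,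
    Finset.sum_eq_single j]
  · rw [← L.assoc (L.inj i), inj_proj, if_pos rfl, L.id_comp, L.assoc, inj_proj, if_pos rfl,
      L.comp_id]
  · intro b _ hb
    rw [L.assoc, L.assoc, L.assoc, inj_proj, if_neg hb]
    simp only [comp_zero]
    rfl
  · exact fun h => (h (Finset.mem_univ j)).elim
  · intro b _ hb
    rw [comp_sum]
    refine Finset.sum_eq_zero fun k _ => ?_
    rw [← L.assoc, inj_proj, if_neg hb.symm]
    exact zero_comp _
  · exact fun h => (h (Finset.mem_univ i)).elim

theorem ofEntries_entries {n m : ℕ} (f : L.Hom n m) : ofEntries (entries f) = f :=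
  entries_injective (entries_ofEntries _)

variable (L) in
/-- Taking matrices is a morphism of theories. -/
noncomputable def entriesMorphism : Morphism L (MatLaw.ofSemiring (L.Hom 1 1)) where
  map f := entries f
  map_id n := by
    change entries (L.id n) = (1 : Matrix (Fin n) (Fin n) (L.Hom 1 1))
    ext i j
    change L.comp (L.inj i) (L.comp (L.id n) (L.proj j)) = _
    rw [L.id_comp, inj_proj, Matrix.one_apply]
    rfl
  map_comp {n m k} f g := by
    change entries (L.comp f g) = entries f * entries g
    ext i j
    rw [Matrix.mul_apply]
    change L.comp (L.inj i) (L.comp (L.comp f g) (L.proj j)) = _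
    have h : L.comp f g = ∑ x, L.comp (L.comp f (L.comp (L.proj x) (L.inj x))) g := by
      rw [← sum_comp, ← comp_sum, sum_proj_inj, L.comp_id]
    rw [h, sum_comp, comp_sum]
    refine Finset.sum_congr rfl fun x _ => ?_
    -- Multiplication of scalars is composition in the reverse of diagrammatic order, so
    -- commutativity is needed to put `f` first.
    refine Eq.trans ?_ (mul_comm (entries g x j) (entries f i x))
    change _ = L.comp (L.comp (L.inj i) (L.comp f (L.proj x)))
      (L.comp (L.inj x) (L.comp g (L.proj j)))
    simp only [L.assoc]
  map_fn {n m} φ := by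
    change entries (L.fn φ) = MatLaw.fn (L.Hom 1 1) φ
    ext i j
    change L.comp (L.inj i) (L.comp (L.fn φ) (L.proj j)) = _
    rw [← L.assoc, inj_fn, inj_proj]
    rfl
  map_tensor {n m p q} f g := by
    change entries (L.tensor f g) = MatLaw.tensor (entries f) (entries g)
    ext x y
    obtain ⟨⟨i, i'⟩, rfl⟩ := finProdFinEquiv.surjective x
    obtain ⟨⟨j, j'⟩, rfl⟩ := finProdFinEquiv.surjective y
    simp only [MatLaw.tensor, Matrix.of_apply, Equiv.symm_apply_apply]
    change L.comp (L.inj _) (L.comp (L.tensor f g) (L.proj _)) = _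
    rw [inj_tensor, proj_tensor]
    refine Eq.trans ?_ (mul_comm (entries g i' j') (entries f i j))
    -- The composite of two entries is read as their tensor; interchange then merges it into an
    -- entry of `f ⊗ g`.
    refine Eq.trans ?_ (tensor_eq_comp _ _)
    refine (congrArg _ (L.tensor_comp f (L.proj j) g (L.proj j')).symm).trans ?_
    exact (L.tensor_comp _ _ _ _).symm
  map_fst n m := by
    change entries (L.fst n m) = MatLaw.fst (L.Hom 1 1) n m
    ext i j
    change L.comp (L.inj i) (L.comp (L.fst n m) (L.proj j)) =
      if i = Fin.castAdd m j then L.id 1 else L.zero 1 1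
    refine Fin.addCases (fun i => ?_) (fun i => ?_) i
    · rw [← inj_inl, L.assoc, ← L.assoc (L.inl n m), L.inl_fst, L.id_comp, inj_proj]
      simp only [Fin.castAdd_inj]
    · rw [← inj_inr, L.assoc, ← L.assoc (L.inr n m), L.inr_fst,
        if_neg (MatLaw.castAdd_ne_natAdd j i).symm]
      exact (congrArg _ (zero_comp _)).trans (comp_zero _)
  map_snd n m := by
    change entries (L.snd n m) = MatLaw.snd (L.Hom 1 1) n m
    ext i j
    change L.comp (L.inj i) (L.comp (L.snd n m) (L.proj j)) =
      if i = Fin.natAdd n j then L.id 1 else L.zero 1 1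
    refine Fin.addCases (fun i => ?_) (fun i => ?_) i
    · rw [← inj_inl, L.assoc, ← L.assoc (L.inl n m), L.inl_snd,
        if_neg (MatLaw.castAdd_ne_natAdd i j)]
      exact (congrArg _ (zero_comp _)).trans (comp_zero _)
    · rw [← inj_inr, L.assoc, ← L.assoc (L.inr n m), L.inr_snd, L.id_comp, inj_proj]
      simp only [Fin.natAdd_inj]

/-- A two-sided inverse on maps of a morphism is a morphism. -/
def Morphism.ofInverse {K : SMBLaw.{u}} (F : Morphism L K)
    (G : ∀ {n m : ℕ}, K.Hom n m → L.Hom n m)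
    (hGF : ∀ {n m : ℕ} (f : L.Hom n m), G (F.map f) = f)
    (hFG : ∀ {n m : ℕ} (f : K.Hom n m), F.map (G f) = f) : Morphism K L where
  map f := G f
  map_id n := by rw [← F.map_id, hGF]
  map_comp f g := by rw [← hGF (L.comp (G f) (G g)), F.map_comp, hFG, hFG]
  map_fn f := by rw [← F.map_fn, hGF]
  map_tensor f g := by rw [← hGF (L.tensor (G f) (G g)), F.map_tensor, hFG, hFG]
  map_fst n m := by rw [← F.map_fst, hGF]
  map_snd n m := by rw [← F.map_snd, hGF]

variable (L) in
/-- The morphism from matrices over the scalars of a theory to the theory. -/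
noncomputable def ofEntriesMorphism : Morphism (MatLaw.ofSemiring (L.Hom 1 1)) L :=
  (entriesMorphism L).ofInverse (fun M => ofEntries M) ofEntries_entries entries_ofEntries

end Entries

end SMBLaw

/-! ### Scalars of a matrix theory -/

namespace MatLaw

variable {S : Type u} [CommSemiring S]

/-- The biproduct sum is the block row `(f g)` times the column of two identity blocks. This makes
`scalarHom` additive. -/
theorem add_apply {n m : ℕ} (f g : (ofSemiring S).Hom n m) (i : Fin n) (j : Fin m) :
    (ofSemiring S).add f g i j = (f i j + g i j : S) := by
  let I : Matrix (Fin m) (Fin m) S := 1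
  rw [SMBLaw.add_eq_tuple]
  change ((Matrix.of fun i j => Fin.append (f i) (g i) j : Matrix (Fin n) (Fin (m + m)) S) *
    (Matrix.of fun i j => Fin.append I I i j : Matrix (Fin (m + m)) (Fin m) S) :
      Matrix (Fin n) (Fin m) S) i j = _
  have hl (x : Fin m) : Fin.append I I (Fin.castAdd m x) j = I x j :=
    congrFun (Fin.append_left I I x) j
  have hr (x : Fin m) : Fin.append I I (Fin.natAdd m x) j = I x j :=
    congrFun (Fin.append_right I I x) j
  rw [Matrix.mul_apply, Fin.sum_univ_add]
  simp only [Matrix.of_apply, Fin.append_left, Fin.append_right, hl, hr]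
  exact congrArg₂ (fun a b : S => a + b)
    (congrFun (congrFun (Matrix.mul_one (f : Matrix (Fin n) (Fin m) S)) i) j)
    (congrFun (congrFun (Matrix.mul_one (g : Matrix (Fin n) (Fin m) S)) i) j)

variable (S) in
/-- Scalars as `1 × 1`-matrices. -/
def scalarHom : S →+* (ofSemiring S).Hom 1 1 where
  toFun s := (Matrix.of fun _ _ => s : Matrix (Fin 1) (Fin 1) S)
  map_one' := by
    change (Matrix.of fun _ _ => 1 : Matrix (Fin 1) (Fin 1) S) = 1
    ext i j
    simp [Matrix.one_apply, Subsingleton.elim i j]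
  map_mul' s t := by
    change (Matrix.of fun _ _ => s * t : Matrix (Fin 1) (Fin 1) S) =
      Matrix.of (fun _ _ => t) * Matrix.of fun _ _ => s
    ext i j
    simp [Matrix.mul_apply, mul_comm]
  map_zero' := by
    change (Matrix.of fun _ _ => 0 : Matrix (Fin 1) (Fin 1) S) =
      (0 : Matrix (Fin 1) (Fin 0) S) * fn S Fin.elim0
    rw [Matrix.zero_mul]
    rfl
  map_add' s t := by
    funext i j
    exact (add_apply (S := S) (Matrix.of fun _ _ => s) (Matrix.of fun _ _ => t) i j).symm

theorem inj_comp_proj {n m : ℕ} (M : Matrix (Fin n) (Fin m) S) (i : Fin n) (j : Fin m) :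
    (ofSemiring S).comp ((ofSemiring S).inj i) ((ofSemiring S).comp M ((ofSemiring S).proj j)) =
      scalarHom S (M i j) := by
  have h : (ofSemiring S).proj j =
      (Matrix.of fun k _ => if k = j then 1 else 0 : Matrix (Fin m) (Fin 1) S) := by
    refine (SMBLaw.eq_proj fun k => ?_).symm
    refine (fn_mul (S := S) (fun _ : Fin 1 => k) _).trans ?_
    change scalarHom S (if k = j then 1 else 0) = _
    rw [apply_ite (scalarHom S), map_one, map_zero]
    rfl
  rw [h]
  refine (fn_mul (S := S) (fun _ : Fin 1 => i) _).trans ?_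
  change (_ : Matrix (Fin 1) (Fin 1) S) = Matrix.of fun _ _ => M i j
  ext a b
  change (M * Matrix.of fun k (_ : Fin 1) => if k = j then (1 : S) else 0) i b = M i j
  simp [Matrix.mul_apply]

end MatLaw

/-! ### The adjunction -/

/-- Morphisms out of a theory of matrices correspond to homomorphisms to the scalars. -/
noncomputable def matHomEquiv (S : CommSemiRingCat.{u}) (L : SMBLaw.{u}) :
    (matFunctor.obj S ⟶ L) ≃ (S ⟶ SMBLaw.homFunctor.obj L) where
  toFun F := CommSemiRingCat.ofHom ((SMBLaw.Morphism.endHom F).comp (MatLaw.scalarHom S))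
  invFun f := matFunctor.map f ≫ L.ofEntriesMorphism
  left_inv F := by
    apply SMBLaw.Morphism.ext
    funext n m M
    apply SMBLaw.entries_injective
    refine (SMBLaw.entries_ofEntries _).trans ?_
    ext i j
    change F.map (MatLaw.scalarHom S (M i j)) =
      L.comp (L.inj i) (L.comp (F.map M) (L.proj j))
    -- Both `inj` and `proj` are pulled inside `F`, leaving `F` of a `1 × 1` matrix.
    have h : F.map (SMBLaw.inj _ i) = L.inj i := F.map_fn _
    rw [← h, ← F.map_proj, ← F.map_comp, ← F.map_comp]
    exact congrArg F.map (MatLaw.inj_comp_proj M i j).symm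
  right_inv f := by
    ext s
    change SMBLaw.ofEntries (Matrix.of fun _ _ => f.hom s : Matrix (Fin 1) (Fin 1) (L.Hom 1 1)) =
      f.hom s
    -- A map `1 → 1` is its own only entry, since `inj 0` and `proj 0` are identities.
    have h := congrFun (congrFun (SMBLaw.entries_ofEntries
      (Matrix.of fun _ _ => f.hom s : Matrix (Fin 1) (Fin 1) (L.Hom 1 1))) 0) 0
    refine Eq.trans ?_ h
    change _ = L.comp (L.inj 0) (L.comp _ (L.proj 0))
    rw [SMBLaw.inj_zero_one, SMBLaw.proj_zero_one, L.id_comp, L.comp_id]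

theorem mainTheorem3 :
    ∃ adj : matFunctor.{u} ⊣ SMBLaw.homFunctor.{u},
      ∀ (S : CommSemiRingCat.{u}) (L : SMBLaw.{u}) (F : matFunctor.obj S ⟶ L) (s : S),
        (adj.homEquiv S L F).hom s =
          SMBLaw.Morphism.map F (n := 1) (m := 1)
            (Matrix.of fun _ _ => s : Matrix (Fin 1) (Fin 1) S) := by
  refine ⟨Adjunction.mkOfHomEquiv
    { homEquiv := matHomEquiv
      homEquiv_naturality_left_symm := fun f g => ?_
      homEquiv_naturality_right := fun f g => rfl }, fun S L F s => ?_⟩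
  -- Naturality in `S` is just functoriality of `matFunctor`, as the inverse transpose postcomposes
  -- with a fixed morphism.
  · change matFunctor.map (f ≫ g) ≫ _ = matFunctor.map f ≫ matFunctor.map g ≫ _
    rw [Functor.map_comp]
    exact Category.assoc _ _ _
  · rw [Adjunction.mkOfHomEquiv_homEquiv]
    rfl
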